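/- Let $K\ge 2$, and let $(n_1(m),\dots,n_K(m))_{m\in\mathbb N}$ be a sequence of pairwise distinct vectors of cluster sizes with $n_k(m)\to\infty$ for every $k$ and $\min_k n_k(m)/\max_k n_k(m)\to c>0$; write $n(m)=\sum_k n_k(m)$. Let $p_{ij}=p_{ji}\in[0,1]$ for $i\ne j$. A random graph on $K$ disjoint clusters of sizes $n_1,\dots,n_K$ follows the random interconnection model (RIM) with interconnection probabilities $\{p_{ij}\}$ if the internal graph of each cluster is (almost surely) connected and otherwise arbitrary, and the edges between nodes of different clusters are mutually independent, an edge between clusters $i\neq j$ being present with probability $p_{ij}$. The RIM is homogeneous if all $p_{ij}$ equal the same number $p$. For a graph Laplacian $L$ let $\lambda_j(L)$ be its $j$-th smallest eigenvalue, counted with multiplicity, and let $S_{2:K}(L)=\sum_{j=2}^K\lambda_j(L)$. For a given sequence of (deterministic) internal graphs of the clusters, the critical threshold $p^*\in[0,1]$ of the homogeneous RIM is the supremum of all $p\in[0,1]$ such that for every $q\in[0,p]$ the homogeneous RIM with these internal graphs and interconnection probability $q$ satisfies $S_{2:K}(L)/n(m)\to (K-1)q$ almost surely as $m\to\infty$,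 whatever the joint distribution of the graphs for different $m$. For each $m$ let $G_m$ be a random graph following the RIM with cluster sizes $n_k(m)$ and interconnection probabilities $\{p_{ij}\}$, all $G_m$ being defined on one probability space with an arbitrary joint distribution, and let $L_m$ be the Laplacian of $G_m$. Let $p_{\min}=\min_{i\ne j}p_{ij}$ and $p_{\max}=\max_{i\neq j}p_{ij}$. Then almost surely the following holds: if $p_{\max}<p^*$, where $p^*$ is the critical threshold for the internal graphs of the clusters of the $G_m$, then $$p_{\min}\;\le\;\liminf_{m\to\infty}\frac{\lambda_j(L_m)}{n(m)}\;\le\;\limsup_{m\to\infty}\frac{\lambda_j(L_m)}{n(m)}\;\le\;p_{\max}\qquad\text{for all } j=2,3,\dots,K.$$ In particular ($j=2$) the normalized algebraic connectivity $\lambda_2(L_m)/n(m)$ lies asymptotically in $[p_{\min},p_{\max}]$ almost surely. -/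

import Mathlib

open MeasureTheory ProbabilityTheory Filter Topology

noncomputable section

namespace RIM

/-- Node set of a graph made of `K` clusters of sizes `n 0, …, n (K - 1)`: the node `⟨k, u⟩` is the
`u`-th node of cluster `k`. -/
abbrev Node {K : ℕ} (n : Fin K → ℕ) : Type := Σ k : Fin K, Fin (n k)

/-- The graph of the internal edges of cluster `k`. -/
def cluster {K : ℕ} {n : Fin K → ℕ} (G : SimpleGraph (Node n)) (k : Fin K) :
    SimpleGraph (Fin (n k)) :=
  G.comap (fun u => (⟨k, u⟩ : Node n))

open scoped Classical in
/-- The graph Laplacian `L = D - A` of a finite graph, as a real matrix. -/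
def laplacian {V : Type*} [Fintype V] (G : SimpleGraph V) : Matrix V V ℝ :=
  G.lapMatrix ℝ

theorem laplacian_isHermitian {V : Type*} [Fintype V] (G : SimpleGraph V) :
    (laplacian G).IsHermitian := by
  classical
  unfold laplacian
  rw [Matrix.IsHermitian, Matrix.conjTranspose_eq_transpose_of_trivial]
  exact G.isSymm_lapMatrix ℝ

open scoped Classical in
/-- `lapEigenvalue G j` is the `j`-th smallest eigenvalue of the graph Laplacian of `G`, counted with
multiplicity, for `1 ≤ j ≤ |V|` (and `0` for other `j`).
`Matrix.IsHermitian.eigenvalues₀` lists the eigenvalues in decreasing order, starting at index `0`. -/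
def lapEigenvalue {V : Type*} [Fintype V] (G : SimpleGraph V) (j : ℕ) : ℝ :=
  if h : 1 ≤ j ∧ j ≤ Fintype.card V then
    (laplacian_isHermitian G).eigenvalues₀ ⟨Fintype.card V - j, by omega⟩
  else 0

/-- The partial eigenvalue sum: the sum of the second to the `K`-th smallest Laplacian eigenvalues. -/
def partialEigenvalueSum {V : Type*} [Fintype V] (G : SimpleGraph V) (K : ℕ) : ℝ :=
  ∑ j ∈ Finset.Icc 2 K, lapEigenvalue G j

/-- The total number of nodes, as a real number. -/
def totalSize {K : ℕ} (n : Fin K → ℕ) : ℝ := ∑ k, (n k : ℝ)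

/-- The size of the smallest cluster. -/
def minSize {K : ℕ} (n : Fin K → ℕ) : ℝ := ⨅ k, (n k : ℝ)

/-- The size of the largest cluster. -/
def maxSize {K : ℕ} (n : Fin K → ℕ) : ℝ := ⨆ k, (n k : ℝ)

/-- The random graph `G` follows the random interconnection model with cluster sizes `n` and
interconnection probabilities `p i j`, `i ≠ j`: each cluster is internally connected and otherwise
arbitrary (deterministic or random), and the edges between different clusters are mutually
independent, an edge between clusters `i` and `j` being present with probability `p i j`. -/
structure IsRIM {Ω : Type*} [MeasurableSpace Ω] (μ : Measure Ω) {K : ℕ} (n : Fin K → ℕ)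
    (p : Fin K → Fin K → ℝ) (G : Ω → SimpleGraph (Node n)) : Prop where
  cluster_connected : ∀ᵐ ω ∂μ, ∀ k : Fin K, (cluster (G ω) k).Connected
  measurableSet_adj : ∀ x y : Node n, x.1 ≠ y.1 → MeasurableSet {ω | (G ω).Adj x y}
  prob_adj : ∀ x y : Node n, x.1 ≠ y.1 → μ {ω | (G ω).Adj x y} = ENNReal.ofReal (p x.1 y.1)
  indep_adj : iIndepSet
    (fun e : {e : Node n × Node n // e.1.1 < e.2.1} => {ω | (G ω).Adj e.1.1 e.1.2}) μ

/-- For the clusters `A m k`, the homogeneous random interconnection model with interconnection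
probability `p` is in the separable phase: if the graphs `G m` follow it and have the internal
graphs `A m k`, then almost surely the partial eigenvalue sum, divided by the number of nodes,
converges to `(K - 1) * p`. -/
def SeparablePhase {K : ℕ} (n : ℕ → Fin K → ℕ) (A : ∀ m k, SimpleGraph (Fin (n m k))) (p : ℝ) :
    Prop :=
  ∀ (Ω : Type) [MeasurableSpace Ω] (μ : Measure Ω) [IsProbabilityMeasure μ]
    (G : ∀ m, Ω → SimpleGraph (Node (n m))),
    (∀ m, IsRIM μ (n m) (fun _ _ => p) (G m)) →
    (∀ m ω k, cluster (G m ω) k = A m k) →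
    ∀ᵐ ω ∂μ, Tendsto (fun m => partialEigenvalueSum (G m ω) K / totalSize (n m)) atTop
      (𝓝 (((K : ℝ) - 1) * p))

/-- The critical phase transition threshold `p*` of the homogeneous random interconnection model
with clusters `A m k`: the largest value up to which every interconnection probability is in the
separable phase. -/
def criticalThreshold {K : ℕ} (n : ℕ → Fin K → ℕ) (A : ∀ m k, SimpleGraph (Fin (n m k))) : ℝ :=
  sSup {p : ℝ | p ∈ Set.Icc (0 : ℝ) 1 ∧ ∀ q ∈ Set.Icc (0 : ℝ) p, SeparablePhase n A q}

/-- The smallest interconnection probability. -/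
def pMin {K : ℕ} (p : Fin K → Fin K → ℝ) : ℝ :=
  ⨅ e : {e : Fin K × Fin K // e.1 ≠ e.2}, p e.1.1 e.1.2

/-- The largest interconnection probability. -/
def pMax {K : ℕ} (p : Fin K → Fin K → ℝ) : ℝ :=
  ⨆ e : {e : Fin K × Fin K // e.1 ≠ e.2}, p e.1.1 e.1.2

end RIM

end

/-! ### Variational bounds for eigenvalues -/

section Variational

variable {E : Type*} [NormedAddCommGroup E] [InnerProductSpace ℝ E]

/-! The Dirichlet energy splits into an internal part, the expected energy of the cross edges, and
an error given by the centred cross adjacency matrix. Almost surely the error is at most `δ * n *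
‖f‖²` for all `f` and all large `m` (`ae_eventually_abs_energy_deviation_le`). Hoeffding's
inequality makes all row sums and row correlations small, which bounds the quadratic form by
Cauchy–Schwarz (`abs_sum_mul_le`). Borel–Cantelli applies because distinct size vectors make the
failure probabilities summable.

Upper bound: on the `K`-dimensional space of cluster-constant functions the internal energy
vanishes, so min-max gives `λ_j ≤ (pMax + δ) n` (`lapEigenvalue_le`).

Lower bound: fix a good outcome and take a homogeneous model with `q = pMin` and the same, now
deterministic, internal graphs. It may live on another probability space: quadratic forms of
individual outcomes are compared, so no coupling is needed. Its eigenvalues exceed those of `G` by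
at most `2δn` (`energy_le_add`, `lapEigenvalue_le_add`). Since `q ≤ pMax < p*`, their normalized sum
over `2..K` tends to `(K - 1) q`; each is at most `q + δ`, so none can be far below `q`. -/

theorem OrthonormalBasis.inner_eq_zero_of_mem_span {ι : Type*} [Fintype ι]
    (b : OrthonormalBasis ι ℝ E) {S : Set ι} {x : E} (hx : x ∈ Submodule.span ℝ (b '' S)) {i : ι}
    (hi : i ∉ S) : inner ℝ (b i) x = 0 := by
  induction hx using Submodule.span_induction with
  | mem x h =>
    obtain ⟨k, hk, rfl⟩ := h
    exact b.inner_eq_zero (by rintro rfl; exact hi hk)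
  | zero => simp
  | add x y _ _ hx hy => simp [inner_add_right, hx, hy]
  | smul a x _ hx => simp [inner_smul_right, hx]

theorem OrthonormalBasis.finrank_span_image {ι : Type*} [Fintype ι]
    (b : OrthonormalBasis ι ℝ E) (S : Finset ι) :
    Module.finrank ℝ (Submodule.span ℝ (b '' (S : Set ι))) = S.card := by
  have h := finrank_span_eq_card (R := ℝ)
    (b.orthonormal.linearIndependent.comp ((↑) : S → ι) Subtype.val_injective)
  have hr : Set.range (b ∘ ((↑) : S → ι)) = b '' (S : Set ι) := by
    rw [Set.range_comp, Subtype.range_coe]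
  rw [← Fintype.card_coe, ← h, hr]

variable [FiniteDimensional ℝ E]

theorem LinearMap.IsSymmetric.inner_apply_self_eq_sum {T : E →ₗ[ℝ] E} (hT : T.IsSymmetric) {N : ℕ}
    (hN : Module.finrank ℝ E = N) (x : E) :
    inner ℝ (T x) x =
      ∑ i, hT.eigenvalues hN i * inner ℝ (hT.eigenvectorBasis hN i) x ^ 2 := by
  rw [← (hT.eigenvectorBasis hN).sum_inner_mul_inner (T x) x]
  refine Finset.sum_congr rfl fun i _ => ?_
  rw [hT x, hT.apply_eigenvectorBasis hN i, real_inner_comm x]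
  simp only [RCLike.ofReal_real_eq_id, id_eq, inner_smul_right]
  ring

theorem LinearMap.IsSymmetric.exists_submodule_inner_le {T : E →ₗ[ℝ] E} (hT : T.IsSymmetric)
    {N : ℕ} (hN : Module.finrank ℝ E = N) (i : Fin N) :
    ∃ V : Submodule ℝ E, Module.finrank ℝ V = N - i ∧
      ∀ x ∈ V, inner ℝ (T x) x ≤ hT.eigenvalues hN i * ‖x‖ ^ 2 := by
  -- Eigenvalues are listed in decreasing order, so the indices from `i` on carry the small ones.
  refine ⟨Submodule.span ℝ (hT.eigenvectorBasis hN '' (Finset.Ici i : Finset (Fin N))), ?_, ?_⟩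
  · rw [OrthonormalBasis.finrank_span_image, Fin.card_Ici]
  · intro x hx
    rw [hT.inner_apply_self_eq_sum hN, ← (hT.eigenvectorBasis hN).sum_sq_inner_right x,
      Finset.mul_sum]
    refine Finset.sum_le_sum fun k _ => ?_
    by_cases hk : i ≤ k
    · exact mul_le_mul_of_nonneg_right (hT.eigenvalues_antitone hN hk) (sq_nonneg _)
    · rw [OrthonormalBasis.inner_eq_zero_of_mem_span _ hx (by simpa using hk)]
      simp

theorem LinearMap.IsSymmetric.eigenvalues_le_of_submodule {T : E →ₗ[ℝ] E} (hT : T.IsSymmetric)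
    {N : ℕ} (hN : Module.finrank ℝ E = N) (i : Fin N) (V : Submodule ℝ E)
    (hV : N - i ≤ Module.finrank ℝ V) {c : ℝ} (hc : ∀ x ∈ V, inner ℝ (T x) x ≤ c * ‖x‖ ^ 2) :
    hT.eigenvalues hN i ≤ c := by
  set W := Submodule.span ℝ (hT.eigenvectorBasis hN '' (Finset.Iic i : Finset (Fin N))) with hW
  have hWdim : Module.finrank ℝ W = i + 1 := by
    rw [hW, OrthonormalBasis.finrank_span_image, Fin.card_Iic]
  -- The dimensions add up to at least `(N - i) + (i + 1) > N`, so the subspaces share a nonzero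
  -- vector.
  have hnd : ¬ Disjoint V W := fun h => by
    have := Submodule.finrank_add_finrank_le_of_disjoint h
    omega
  rw [Submodule.disjoint_def] at hnd
  push Not at hnd
  obtain ⟨x, hxV, hxW, hx0⟩ := hnd
  have h1 : hT.eigenvalues hN i * ‖x‖ ^ 2 ≤ inner ℝ (T x) x := by
    rw [hT.inner_apply_self_eq_sum hN, ← (hT.eigenvectorBasis hN).sum_sq_inner_right x,
      Finset.mul_sum]
    refine Finset.sum_le_sum fun k _ => ?_
    by_cases hk : k ≤ i
    · exact mul_le_mul_of_nonneg_right (hT.eigenvalues_antitone hN hk) (sq_nonneg _)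
    · rw [OrthonormalBasis.inner_eq_zero_of_mem_span _ hxW (by simpa using hk)]
      simp
  exact le_of_mul_le_mul_right (h1.trans (hc x hxV)) (by positivity)

end Variational

namespace RIM

/-! ### Min-max for the Laplacian in terms of Dirichlet energy. -/

section Energy

variable {V : Type*} [Fintype V]

open scoped Classical in
/-- The Dirichlet energy of a function on the nodes, the quadratic form of the Laplacian. -/
noncomputable def energy (G : SimpleGraph V) (f : V → ℝ) : ℝ :=
  (∑ x, ∑ y, if G.Adj x y then (f x - f y) ^ 2 else 0) / 2

open scoped Classical in
theorem inner_laplacian (G : SimpleGraph V) (x : EuclideanSpace ℝ V) :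
    inner ℝ (Matrix.toEuclideanLin (laplacian G) x) x = energy G x := by
  rw [energy, ← SimpleGraph.lapMatrix_toLinearMap₂' ℝ G, Matrix.toLinearMap₂'_apply',
    real_inner_comm, EuclideanSpace.inner_eq_star_dotProduct, dotProduct_comm]
  simp [laplacian, Matrix.toLpLin_apply]

theorem lapEigenvalue_le_of_submodule (G : SimpleGraph V) {j : ℕ} (hj : 1 ≤ j)
    (hjc : j ≤ Fintype.card V) (W : Submodule ℝ (V → ℝ)) (hW : j ≤ Module.finrank ℝ W) {c : ℝ}
    (hc : ∀ f ∈ W, energy G f ≤ c * ∑ x, f x ^ 2) : lapEigenvalue G j ≤ c := by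
  classical
  rw [lapEigenvalue, dif_pos ⟨hj, hjc⟩, Matrix.IsHermitian.eigenvalues₀]
  refine LinearMap.IsSymmetric.eigenvalues_le_of_submodule _ _ _
    (W.comap (WithLp.linearEquiv 2 ℝ (V → ℝ)).toLinearMap) ?_ fun x hx => ?_
  · have : Module.finrank ℝ (W.comap (WithLp.linearEquiv 2 ℝ (V → ℝ)).toLinearMap)
        = Module.finrank ℝ W := by
      rw [← LinearEquiv.finrank_eq (LinearEquiv.ofSubmodule' (WithLp.linearEquiv 2 ℝ (V → ℝ)) W)]
    rw [this]
    simp only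
    omega
  · have := hc x hx
    rw [EuclideanSpace.real_norm_sq_eq]
    convert! this using 1
    convert! inner_laplacian G x

theorem exists_submodule_energy_le (G : SimpleGraph V) {j : ℕ} (hj : 1 ≤ j)
    (hjc : j ≤ Fintype.card V) : ∃ W : Submodule ℝ (V → ℝ), Module.finrank ℝ W = j ∧
      ∀ f ∈ W, energy G f ≤ lapEigenvalue G j * ∑ x, f x ^ 2 := by
  classical
  obtain ⟨W, hW, h⟩ := LinearMap.IsSymmetric.exists_submodule_inner_le
    (Matrix.isSymmetric_toEuclideanLin_iff.mpr (laplacian_isHermitian G)) finrank_euclideanSpace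
    ⟨Fintype.card V - j, by omega⟩
  refine ⟨W.comap (WithLp.linearEquiv 2 ℝ (V → ℝ)).symm.toLinearMap, ?_, fun f hf => ?_⟩
  · rw [LinearEquiv.finrank_eq
      (LinearEquiv.ofSubmodule' (WithLp.linearEquiv 2 ℝ (V → ℝ)).symm W), hW]
    simp only
    omega
  · have := h _ hf
    rw [EuclideanSpace.real_norm_sq_eq] at this
    rw [lapEigenvalue, dif_pos ⟨hj, hjc⟩, Matrix.IsHermitian.eigenvalues₀]
    convert! this using 1
    convert! (inner_laplacian G (WithLp.toLp 2 f)).symm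

/-- A `j`-dimensional space on which the form of `G` is small is a trial space for `H`. -/
theorem lapEigenvalue_le_add (G H : SimpleGraph V) {j : ℕ} (hj : 1 ≤ j)
    (hjc : j ≤ Fintype.card V) {c : ℝ}
    (h : ∀ f : V → ℝ, energy H f ≤ energy G f + c * ∑ x, f x ^ 2) :
    lapEigenvalue H j ≤ lapEigenvalue G j + c := by
  obtain ⟨W, hW, hG⟩ := exists_submodule_energy_le G hj hjc
  refine lapEigenvalue_le_of_submodule H hj hjc W hW.ge fun f hf => ?_
  linarith [h f, hG f hf]

end Energy

/-! ### Quadratic forms with small row sums and correlations -/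

/-- Cauchy–Schwarz bound for a quadratic form whose matrix has nearly orthogonal rows. -/
theorem abs_sum_mul_le {V : Type*} [Fintype V] (M : V → V → ℝ) {N ε : ℝ} (hN : 0 ≤ N)
    (hcard : (Fintype.card V : ℝ) ≤ N) (hN1 : 1 ≤ ε * N) (hM1 : ∀ x y, |M x y| ≤ 1)
    (hcorr : ∀ x x', x ≠ x' → |∑ y, M x y * M x' y| ≤ ε * N) (f : V → ℝ) :
    (∑ x, ∑ y, M x y * f x * f y) ^ 2 ≤ 2 * ε * N ^ 2 * (∑ x, f x ^ 2) ^ 2 := by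
  classical
  have hS : 0 ≤ ∑ x, f x ^ 2 := Finset.sum_nonneg fun _ _ => sq_nonneg _
  have hCS : (∑ x, ∑ y, M x y * f x * f y) ^ 2 ≤
      (∑ y, (∑ x, M x y * f x) ^ 2) * ∑ y, f y ^ 2 := by
    rw [Finset.sum_comm]
    simp_rw [← Finset.sum_mul]
    exact Finset.sum_mul_sq_le_sq_mul_sq _ _ _
  -- Expanding the square gives the Gram matrix of the rows: diagonal entries at most `N`, the
  -- others at most `ε * N`.
  have hexp : ∑ y, (∑ x, M x y * f x) ^ 2 =
      ∑ x, ∑ x', (∑ y, M x y * M x' y) * (f x * f x') := by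
    simp_rw [sq, Finset.sum_mul_sum, Finset.sum_mul]
    rw [Finset.sum_comm]
    refine Finset.sum_congr rfl fun x _ => ?_
    rw [Finset.sum_comm]
    exact Finset.sum_congr rfl fun _ _ => Finset.sum_congr rfl fun _ _ => by ring
  have hterm : ∀ x x', (∑ y, M x y * M x' y) * (f x * f x') ≤
      ε * N * (|f x| * |f x'|) + if x = x' then N * f x ^ 2 else 0 := by
    intro x x'
    have hff : 0 ≤ |f x| * |f x'| := by positivity
    split_ifs with h
    · subst h
      have h1 : ∑ y, M x y * M x y ≤ N := by
        refine le_trans (Finset.sum_le_card_nsmul _ _ 1 fun y _ => ?_) (by simpa using hcard)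
        rw [← abs_mul_abs_self]
        nlinarith [hM1 x y, abs_nonneg (M x y)]
      have h2 : 0 ≤ ε * N * (|f x| * |f x|) := by positivity
      nlinarith [mul_le_mul_of_nonneg_right h1 (sq_nonneg (f x))]
    · rw [add_zero]
      refine (le_abs_self _).trans ?_
      rw [abs_mul, abs_mul]
      exact mul_le_mul_of_nonneg_right (hcorr x x' h) hff
  have hsum : ∑ x, ∑ x', (∑ y, M x y * M x' y) * (f x * f x') ≤
      ε * N * (∑ x, |f x|) ^ 2 + N * ∑ x, f x ^ 2 := by
    refine (Finset.sum_le_sum fun x _ => Finset.sum_le_sum fun x' _ => hterm x x').trans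
      (le_of_eq ?_)
    simp_rw [Finset.sum_add_distrib, Finset.sum_ite_eq, Finset.mem_univ, if_true, ← Finset.mul_sum]
    rw [sq, Finset.sum_mul_sum]
    simp_rw [← Finset.mul_sum]
  have habs : (∑ x, |f x|) ^ 2 ≤ N * ∑ x, f x ^ 2 := by
    have := sq_sum_le_card_mul_sum_sq (s := Finset.univ) (f := fun x => |f x|)
    simp only [sq_abs, Finset.card_univ] at this
    exact this.trans (mul_le_mul_of_nonneg_right hcard hS)
  have hεN : 0 ≤ ε * N := by positivity
  have hfin : ∑ y, (∑ x, M x y * f x) ^ 2 ≤ 2 * ε * N ^ 2 * ∑ x, f x ^ 2 := by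
    rw [hexp]
    refine hsum.trans ?_
    have h1 := mul_le_mul_of_nonneg_left habs hεN
    have h2 := mul_le_mul_of_nonneg_right hN1 (mul_nonneg hN hS)
    nlinarith
  calc _ ≤ _ := hCS
    _ ≤ (2 * ε * N ^ 2 * ∑ x, f x ^ 2) * ∑ x, f x ^ 2 := mul_le_mul_of_nonneg_right hfin hS
    _ = _ := by ring

/-- The form is the diagonal of row sums minus the bilinear form of `M`; each gets half of `δ`. The
constant `δ ^ 2 / 8` is chosen so that `2 * (δ ^ 2 / 8) * N ^ 2 = (δ / 2 * N) ^ 2`. -/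
theorem abs_sum_mul_sub_sq_le {V : Type*} [Fintype V] (M : V → V → ℝ) (hsymm : ∀ x y, M x y = M y x)
    {N δ : ℝ} (hN : 0 ≤ N) (hδ : 0 ≤ δ) (hδ1 : δ ≤ 1)
    (hcard : (Fintype.card V : ℝ) ≤ N) (hN1 : 1 ≤ δ ^ 2 / 8 * N) (hM1 : ∀ x y, |M x y| ≤ 1)
    (hrow : ∀ x, |∑ y, M x y| ≤ δ ^ 2 / 8 * N)
    (hcorr : ∀ x x', x ≠ x' → |∑ y, M x y * M x' y| ≤ δ ^ 2 / 8 * N) (f : V → ℝ) :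
    |(∑ x, ∑ y, M x y * (f x - f y) ^ 2) / 2| ≤ δ * N * ∑ x, f x ^ 2 := by
  have hS : 0 ≤ ∑ x, f x ^ 2 := Finset.sum_nonneg fun _ _ => sq_nonneg _
  have hquad : |∑ x, ∑ y, M x y * f x * f y| ≤ δ / 2 * N * ∑ x, f x ^ 2 := by
    refine abs_le_of_sq_le_sq ?_ (by positivity)
    refine (abs_sum_mul_le M hN hcard hN1 hM1 hcorr f).trans (le_of_eq ?_)
    ring
  have hdiag : |∑ x, (∑ y, M x y) * f x ^ 2| ≤ δ / 2 * N * ∑ x, f x ^ 2 := by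
    refine (Finset.abs_sum_le_sum_abs _ _).trans ?_
    rw [Finset.mul_sum]
    refine Finset.sum_le_sum fun x _ => ?_
    rw [abs_mul, abs_sq]
    refine mul_le_mul_of_nonneg_right ((hrow x).trans ?_) (sq_nonneg _)
    exact mul_le_mul_of_nonneg_right (by nlinarith) hN
  have hsplit : (∑ x, ∑ y, M x y * (f x - f y) ^ 2) / 2 =
      ∑ x, (∑ y, M x y) * f x ^ 2 - ∑ x, ∑ y, M x y * f x * f y := by
    have h1 : ∑ x, ∑ y, M x y * f y ^ 2 = ∑ x, ∑ y, M x y * f x ^ 2 := by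
      rw [Finset.sum_comm]
      exact Finset.sum_congr rfl fun x _ => Finset.sum_congr rfl fun y _ => by rw [hsymm]
    have h2 : ∑ x, ∑ y, M x y * (f x - f y) ^ 2 = ∑ x, ∑ y, M x y * f x ^ 2 +
        ∑ x, ∑ y, M x y * f y ^ 2 - 2 * ∑ x, ∑ y, M x y * f x * f y := by
      simp_rw [Finset.mul_sum, ← Finset.sum_add_distrib, ← Finset.sum_sub_distrib]
      exact Finset.sum_congr rfl fun x _ => Finset.sum_congr rfl fun y _ => by ring
    rw [h2, h1]
    simp_rw [Finset.sum_mul]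
    ring
  rw [hsplit]
  refine (abs_sub _ _).trans ?_
  linarith

end RIM

/-! ### Independence and concentration -/

section Concentration

variable {Ω : Type*} [MeasurableSpace Ω] {μ : Measure Ω}

/-- Disjoint blocks of an independent family are independent. -/
theorem ProbabilityTheory.iIndepFun.sigma_curry {ι : Type*} {κ : ι → Type*}
    {𝓧 : (i : ι) → κ i → Type*} [∀ i j, MeasurableSpace (𝓧 i j)]
    {X : (i : ι) → (j : κ i) → Ω → 𝓧 i j} (mX : ∀ i j, Measurable (X i j))
    (h : iIndepFun (fun (q : (i : ι) × κ i) ω => X q.1 q.2 ω) μ) :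
    iIndepFun (fun i ω => (X i · ω)) μ := by
  have := h.isProbabilityMeasure
  have : ∀ i j, IsProbabilityMeasure (μ.map (X i j)) :=
    fun i j => Measure.isProbabilityMeasure_map (mX i j).aemeasurable
  have hcomp : (fun ω i j => X i j ω) =
      (MeasurableEquiv.piCurry 𝓧) ∘ (fun ω (q : (i : ι) × κ i) => X q.1 q.2 ω) := by
    ext; simp [Sigma.curry]
  rw [iIndepFun_iff_map_fun_eq_infinitePi_map (by fun_prop), hcomp,
    ← Measure.map_map (by fun_prop) (by fun_prop),
    (iIndepFun_iff_map_fun_eq_infinitePi_map (by fun_prop)).1 h,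
    Measure.infinitePi_map_piCurry (fun i j => μ.map (X i j))]
  congr 1
  funext i
  exact ((iIndepFun_iff_map_fun_eq_infinitePi_map (by fun_prop)).1
    (h.precomp (g := fun j => ⟨i, j⟩) sigma_mk_injective)).symm

/-- **Hoeffding's inequality**, two-sided, for centred variables bounded by `1`. -/
theorem measureReal_abs_sum_ge_le [IsProbabilityMeasure μ] {ι : Type*} [Fintype ι]
    {Z : ι → Ω → ℝ} (hind : iIndepFun Z μ) (hm : ∀ i, Measurable (Z i))
    (hb : ∀ i ω, |Z i ω| ≤ 1) (h0 : ∀ i, ∫ ω, Z i ω ∂μ = 0) {N t : ℝ}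
    (hcard : (Fintype.card ι : ℝ) ≤ N) (ht : 0 ≤ t) :
    μ.real {ω | t ≤ |∑ i, Z i ω|} ≤ 2 * Real.exp (-t ^ 2 / (2 * N)) := by
  have key : ∀ Y : ι → Ω → ℝ, iIndepFun Y μ → (∀ i, Measurable (Y i)) → (∀ i ω, |Y i ω| ≤ 1) →
      (∀ i, ∫ ω, Y i ω ∂μ = 0) →
      μ.real {ω | t ≤ ∑ i, Y i ω} ≤ Real.exp (-t ^ 2 / (2 * N)) := by
    intro Y hY hYm hYb hY0
    have hsub : ∀ i, HasSubgaussianMGF (Y i) 1 μ := fun i => by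
      have := hasSubgaussianMGF_of_mem_Icc_of_integral_eq_zero (a := -1) (b := 1)
        (hYm i).aemeasurable (ae_of_all _ fun ω => abs_le.1 (hYb i ω)) (hY0 i)
      convert this
      ext
      norm_num
    -- The exponent comparison below divides by the number of terms, so the empty sum is treated
    -- apart.
    by_cases hι : IsEmpty ι
    · rcases ht.eq_or_lt with rfl | ht'
      · simp
      · simpa [ht'.not_ge] using (Real.exp_pos _).le
    · rw [not_isEmpty_iff] at hι
      have h := HasSubgaussianMGF.measure_sum_ge_le_of_iIndepFun hY (c := fun _ => 1)
        (s := Finset.univ) (fun i _ => hsub i) ht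
      refine h.trans (Real.exp_le_exp.2 ?_)
      have hc : (0 : ℝ) < Fintype.card ι := by exact_mod_cast Fintype.card_pos
      simp only [Finset.sum_const, Finset.card_univ, nsmul_eq_mul, mul_one, NNReal.coe_natCast]
      rw [neg_div, neg_div, neg_le_neg_iff]
      exact div_le_div_of_nonneg_left (sq_nonneg _) (by positivity) (by linarith)
  have h1 := key Z hind hm hb h0
  have h2 := key (fun i ω => -Z i ω) (hind.comp (fun _ x => -x) fun _ => measurable_neg)
    (fun i => (hm i).neg) (fun i ω => by simpa using hb i ω)
    (fun i => by rw [integral_neg, h0, neg_zero])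
  have hsub : {ω | t ≤ |∑ i, Z i ω|} ⊆ {ω | t ≤ ∑ i, Z i ω} ∪ {ω | t ≤ ∑ i, -Z i ω} := by
    intro ω hω
    simpa [le_abs] using hω
  calc _ ≤ _ := measureReal_mono hsub
    _ ≤ _ := measureReal_union_le _ _
    _ ≤ _ := by linarith

end Concentration

/-- A product of `K` geometric series; it dominates any sum over pairwise distinct size vectors. -/
theorem summable_pow_sum_fin {r : ℝ} (h0 : 0 ≤ r) (h1 : r < 1) (K : ℕ) :
    Summable fun v : Fin K → ℕ => r ^ (∑ k, v k) := by
  induction K with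
  | zero => exact .of_finite
  | succ K ih =>
    rw [← (Fin.consEquiv fun _ : Fin (K + 1) => ℕ).summable_iff]
    have := (summable_geometric_of_lt_one h0 h1).mul_of_nonneg ih
      (fun _ => pow_nonneg h0 _) (fun _ => pow_nonneg h0 _)
    refine this.congr fun q => ?_
    simp [Fin.consEquiv, Fin.sum_univ_succ, pow_add]

namespace RIM

/-! ### Concentration of the centred cross adjacency matrix. -/

section Deviation

variable {K : ℕ} {n : Fin K → ℕ} {p : Fin K → Fin K → ℝ}

theorem totalSize_eq_card (n : Fin K → ℕ) : totalSize n = Fintype.card (Node n) := by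
  simp [totalSize]

open scoped Classical in
/-- The centred adjacency matrix of the edges between different clusters. -/
noncomputable def deviation (p : Fin K → Fin K → ℝ) (G : SimpleGraph (Node n)) (x y : Node n) : ℝ :=
  if x.1 = y.1 then 0 else (if G.Adj x y then 1 else 0) - p x.1 y.1

theorem deviation_of_eq (G : SimpleGraph (Node n)) {x y : Node n} (h : x.1 = y.1) :
    deviation p G x y = 0 := if_pos h

theorem deviation_symm (hp : ∀ i j, p i j = p j i) (G : SimpleGraph (Node n)) (x y : Node n) :
    deviation p G x y = deviation p G y x := by
  unfold deviation
  rw [hp x.1 y.1]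
  by_cases h : G.Adj x y
  · simp only [h, h.symm, eq_comm (a := x.1) (b := y.1)]
  · simp only [h, mt SimpleGraph.Adj.symm h, eq_comm (a := x.1) (b := y.1)]

theorem abs_deviation_le (hp : ∀ i j, i ≠ j → p i j ∈ Set.Icc (0 : ℝ) 1)
    (G : SimpleGraph (Node n)) (x y : Node n) : |deviation p G x y| ≤ 1 := by
  unfold deviation
  split_ifs with h h'
  · simp
  all_goals
    have := hp _ _ h
    rw [abs_le]
    constructor <;> linarith [this.1, this.2]

/-- The pairs of nodes in different clusters, ordered by cluster. -/
abbrev CrossPair (n : Fin K → ℕ) : Type := {e : Node n × Node n // e.1.1 < e.2.1}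

/-- The ordered pair with the nodes `x` and `y` of different clusters. -/
def crossPair (x y : Node n) (h : x.1 ≠ y.1) : CrossPair n :=
  if h' : x.1 < y.1 then ⟨(x, y), h'⟩ else ⟨(y, x), lt_of_le_of_ne (not_lt.1 h') h.symm⟩

theorem crossPair_eq_iff {x y x' y' : Node n} {h : x.1 ≠ y.1} {h' : x'.1 ≠ y'.1} :
    crossPair x y h = crossPair x' y' h' ↔ (x = x' ∧ y = y') ∨ (x = y' ∧ y = x') := by
  constructor
  · unfold crossPair
    split_ifs <;> simp only [Subtype.mk.injEq, Prod.mk.injEq] <;> tauto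
  · rintro (⟨rfl, rfl⟩ | ⟨rfl, rfl⟩)
    · rfl
    · unfold crossPair
      split_ifs with h1 h2 h2
      · exact absurd h1 h2.asymm
      · rfl
      · rfl
      · exact absurd (le_antisymm (not_lt.1 h1) (not_lt.1 h2)) h'

theorem deviation_crossPair (hp : ∀ i j, p i j = p j i) (G : SimpleGraph (Node n)) (x y : Node n)
    (h : x.1 ≠ y.1) :
    deviation p G (crossPair x y h).1.1 (crossPair x y h).1.2 = deviation p G x y := by
  unfold crossPair
  split_ifs
  · rfl
  · exact deviation_symm hp G y x

theorem deviation_eq_indicator {Ω : Type*} {G : Ω → SimpleGraph (Node n)} {x y : Node n} (h : x.1 ≠ y.1) (ω : Ω) :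
    deviation p (G ω) x y = {ω | (G ω).Adj x y}.indicator (fun _ => (1 : ℝ)) ω - p x.1 y.1 := by
  classical
  rw [deviation, if_neg h, Set.indicator_apply]
  simp only [Set.mem_ofPred_eq]

variable {Ω : Type*} [MeasurableSpace Ω] {μ : Measure Ω} {G : Ω → SimpleGraph (Node n)}

theorem IsRIM.measurable_deviation (hG : IsRIM μ n p G) (x y : Node n) :
    Measurable fun ω => deviation p (G ω) x y := by
  by_cases h : x.1 = y.1
  · simp_rw [deviation_of_eq _ h]
    exact measurable_const
  · simp_rw [deviation_eq_indicator h]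
    exact (measurable_const.indicator (hG.measurableSet_adj x y h)).sub_const _

theorem IsRIM.integral_deviation [IsProbabilityMeasure μ] (hG : IsRIM μ n p G)
    (hp : ∀ i j, i ≠ j → p i j ∈ Set.Icc (0 : ℝ) 1) (x y : Node n) :
    ∫ ω, deviation p (G ω) x y ∂μ = 0 := by
  by_cases h : x.1 = y.1
  · simp_rw [deviation_of_eq _ h, integral_zero]
  · have hm := hG.measurableSet_adj x y h
    simp_rw [deviation_eq_indicator h]
    rw [integral_sub ((integrable_const _).indicator hm) (integrable_const _),
      integral_indicator_const _ hm, measureReal_def, hG.prob_adj x y h,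
      ENNReal.toReal_ofReal (hp _ _ h).1]
    simp

theorem IsRIM.iIndepFun_deviation (hG : IsRIM μ n p G) :
    iIndepFun (fun (e : CrossPair n) ω => deviation p (G ω) e.1.1 e.1.2) μ := by
  have h := (hG.indep_adj.iIndepFun_indicator (β := ℝ)).comp
    (fun (e : CrossPair n) t => t - p e.1.1.1 e.1.2.1) fun _ => measurable_id.sub_const _
  convert h using 2 with e
  funext ω
  exact deviation_eq_indicator e.2.ne ω

theorem IsRIM.measureReal_row_le [IsProbabilityMeasure μ] (hG : IsRIM μ n p G)
    (hp : ∀ i j, i ≠ j → p i j ∈ Set.Icc (0 : ℝ) 1) (hps : ∀ i j, p i j = p j i) (x : Node n)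
    {t : ℝ} (ht : 0 ≤ t) :
    μ.real {ω | t ≤ |∑ y, deviation p (G ω) x y|} ≤
      2 * Real.exp (-t ^ 2 / (2 * totalSize n)) := by
  classical
  have hsum : ∀ ω, ∑ y, deviation p (G ω) x y =
      ∑ y : {y : Node n // x.1 ≠ y.1}, deviation p (G ω) x y := fun ω => by
    rw [← Fintype.sum_subtype_add_sum_subtype (fun y : Node n => x.1 ≠ y.1),
      add_eq_left]
    exact Finset.sum_eq_zero fun y _ => deviation_of_eq _ (not_not.1 y.2)
  simp_rw [hsum]
  refine measureReal_abs_sum_ge_le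
    (Z := fun (y : {y : Node n // x.1 ≠ y.1}) ω => deviation p (G ω) x y) ?_
    (fun y => hG.measurable_deviation x y) (fun y ω => abs_deviation_le hp _ _ _)
    (fun y => hG.integral_deviation hp x y) ?_ ht
  · have := hG.iIndepFun_deviation.precomp
      (g := fun y : {y : Node n // x.1 ≠ y.1} => crossPair x y y.2) fun y y' h => by
        rcases crossPair_eq_iff.1 h with h | h
        · exact Subtype.ext h.2
        · exact absurd (congrArg Sigma.fst h.1) y'.2
    simpa only [deviation_crossPair hps] using this
  · rw [totalSize_eq_card]
    exact_mod_cast Fintype.card_subtype_le _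

/-- Only nodes `y` outside the clusters of both `x` and `x'` contribute. For each such `y` the edges
to `x` and `x'` are distinct, so the product is centred; for different `y` the two-edge blocks are
disjoint, so the products are independent. -/
theorem IsRIM.measureReal_correlation_le [IsProbabilityMeasure μ] (hG : IsRIM μ n p G)
    (hp : ∀ i j, i ≠ j → p i j ∈ Set.Icc (0 : ℝ) 1) (hps : ∀ i j, p i j = p j i) {x x' : Node n}
    (hx : x ≠ x') {t : ℝ} (ht : 0 ≤ t) :
    μ.real {ω | t ≤ |∑ y, deviation p (G ω) x y * deviation p (G ω) x' y|} ≤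
      2 * Real.exp (-t ^ 2 / (2 * totalSize n)) := by
  classical
  have hsum : ∀ ω, ∑ y, deviation p (G ω) x y * deviation p (G ω) x' y =
      ∑ y : {y : Node n // x.1 ≠ y.1 ∧ x'.1 ≠ y.1},
        deviation p (G ω) x y * deviation p (G ω) x' y := fun ω => by
    rw [← Fintype.sum_subtype_add_sum_subtype (fun y : Node n => x.1 ≠ y.1 ∧ x'.1 ≠ y.1),
      add_eq_left]
    refine Finset.sum_eq_zero fun y _ => ?_
    rcases not_and_or.1 y.2 with h | h
    · rw [deviation_of_eq _ (not_not.1 h), zero_mul]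
    · rw [deviation_of_eq _ (not_not.1 h), mul_zero]
  simp_rw [hsum]
  let ι := {y : Node n // x.1 ≠ y.1 ∧ x'.1 ≠ y.1}
  let pair : (_ : ι) × Bool → CrossPair n := fun q =>
    bif q.2 then crossPair x q.1 q.1.2.1 else crossPair x' q.1 q.1.2.2
  -- Two cross pairs coincide only if equal or swapped; a swap would identify `x` or `x'` with a
  -- node from another cluster.
  have hpair : Function.Injective pair := by
    rintro ⟨y, b⟩ ⟨y', b'⟩ h
    have h1 : ∀ z : ι, x ≠ z := fun z hz => z.2.1 (congrArg Sigma.fst hz)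
    have h2 : ∀ z : ι, x' ≠ z := fun z hz => z.2.2 (congrArg Sigma.fst hz)
    cases b <;> cases b' <;> simp only [pair, cond_true, cond_false] at h <;>
      rcases crossPair_eq_iff.1 h with h | h
    · rw [Subtype.ext h.2]
    · exact absurd h.1 (h2 _)
    · exact absurd h.1.symm hx
    · exact absurd h.1 (h2 _)
    · exact absurd h.1 hx
    · exact absurd h.1 (h1 _)
    · rw [Subtype.ext h.2]
    · exact absurd h.1 (h1 _)
  have hblock := (hG.iIndepFun_deviation.precomp hpair).sigma_curry
    (X := fun y b ω => deviation p (G ω) (pair ⟨y, b⟩).1.1 (pair ⟨y, b⟩).1.2)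
    fun y b => hG.measurable_deviation _ _
  have hdev : ∀ (y : ι) ω, deviation p (G ω) x y =
      deviation p (G ω) (pair ⟨y, true⟩).1.1 (pair ⟨y, true⟩).1.2 := fun y ω =>
    (deviation_crossPair hps (G ω) x y y.2.1).symm
  have hdev' : ∀ (y : ι) ω, deviation p (G ω) x' y =
      deviation p (G ω) (pair ⟨y, false⟩).1.1 (pair ⟨y, false⟩).1.2 := fun y ω =>
    (deviation_crossPair hps (G ω) x' y y.2.2).symm
  refine measureReal_abs_sum_ge_le
    (Z := fun (y : ι) ω => deviation p (G ω) x y * deviation p (G ω) x' y) ?_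
    (fun y => (hG.measurable_deviation x y).mul (hG.measurable_deviation x' y)) (fun y ω => ?_)
    (fun y => ?_) ?_ ht
  · simp_rw [hdev, hdev']
    exact hblock.comp (fun _ v => v true * v false) fun _ => by fun_prop
  · rw [abs_mul]
    exact mul_le_one₀ (abs_deviation_le hp _ _ _) (abs_nonneg _) (abs_deviation_le hp _ _ _)
  · have hind : IndepFun (fun ω => deviation p (G ω) x y) (fun ω => deviation p (G ω) x' y) μ := by
      simp_rw [hdev, hdev']
      exact hG.iIndepFun_deviation.indepFun (hpair.ne (by simp))
    rw [hind.integral_fun_mul_eq_mul_integral (hG.measurable_deviation x y).aestronglyMeasurable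
      (hG.measurable_deviation x' y).aestronglyMeasurable, hG.integral_deviation hp, zero_mul]
  · rw [totalSize_eq_card]
    exact_mod_cast Fintype.card_subtype_le _

/-- The rows of the centred adjacency matrix have small sums and small correlations. -/
def IsQuasirandom (p : Fin K → Fin K → ℝ) (G : SimpleGraph (Node n)) (t : ℝ) : Prop :=
  (∀ x, |∑ y, deviation p G x y| ≤ t) ∧
    ∀ x x', x ≠ x' → |∑ y, deviation p G x y * deviation p G x' y| ≤ t

theorem IsRIM.measureReal_not_isQuasirandom_le [IsProbabilityMeasure μ] (hG : IsRIM μ n p G)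
    (hp : ∀ i j, i ≠ j → p i j ∈ Set.Icc (0 : ℝ) 1) (hps : ∀ i j, p i j = p j i)
    {t : ℝ} (ht : 0 ≤ t) :
    μ.real {ω | ¬ IsQuasirandom p (G ω) t} ≤
      4 * totalSize n ^ 2 * Real.exp (-t ^ 2 / (2 * totalSize n)) := by
  -- Union bound over pairs of nodes; the row event and the correlation event each cost twice the
  -- exponential, hence the factor 4.
  have hsub : {ω | ¬ IsQuasirandom p (G ω) t} ⊆ ⋃ q : Node n × Node n,
      {ω | t ≤ |∑ y, deviation p (G ω) q.1 y|} ∪ {ω | q.1 ≠ q.2 ∧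
        t ≤ |∑ y, deviation p (G ω) q.1 y * deviation p (G ω) q.2 y|} := by
    intro ω hω
    simp only [Set.mem_iUnion, Set.mem_union, Set.mem_ofPred_eq, Prod.exists]
    by_contra! hcon
    exact hω ⟨fun x => (hcon x x).1.le, fun x x' h => ((hcon x x').2 h).le⟩
  calc _ ≤ _ := measureReal_mono hsub
    _ ≤ _ := measureReal_iUnion_fintype_le _
    _ ≤ ∑ _q : Node n × Node n, 4 * Real.exp (-t ^ 2 / (2 * totalSize n)) := by
        refine Finset.sum_le_sum fun q _ => (measureReal_union_le _ _).trans ?_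
        have h1 := hG.measureReal_row_le hp hps q.1 ht
        have h2 : μ.real {ω | q.1 ≠ q.2 ∧
            t ≤ |∑ y, deviation p (G ω) q.1 y * deviation p (G ω) q.2 y|} ≤
              2 * Real.exp (-t ^ 2 / (2 * totalSize n)) := by
          by_cases hq : q.1 = q.2
          · simp only [hq, ne_eq, not_true_eq_false, false_and, Set.ofPred_false,
              measureReal_empty]
            positivity
          · simpa [hq] using hG.measureReal_correlation_le hp hps hq ht
        linarith
    _ = _ := by
        rw [Finset.sum_const, Finset.card_univ, Fintype.card_prod, totalSize_eq_card]
        simp only [nsmul_eq_mul, Nat.cast_mul]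
        ring

end Deviation

/-! ### Almost sure control by Borel–Cantelli. -/

variable {K : ℕ} {Ω : Type*} [MeasurableSpace Ω] {μ : Measure Ω} {n : ℕ → Fin K → ℕ}
  {p : Fin K → Fin K → ℝ} {G : ∀ m, Ω → SimpleGraph (Node (n m))}

theorem totalSize_nonneg (n : Fin K → ℕ) : 0 ≤ totalSize n :=
  Finset.sum_nonneg fun _ _ => Nat.cast_nonneg _

theorem summable_sq_mul_exp_totalSize (hn : Function.Injective n) {a : ℝ} (ha : 0 < a) :
    Summable fun m => totalSize (n m) ^ 2 * Real.exp (-(2 * a) * totalSize (n m)) := by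
  have hs := ((summable_pow_sum_fin (Real.exp_pos (-a)).le
    (Real.exp_lt_one_iff.2 (neg_lt_zero.2 ha)) K).comp_injective hn).mul_left (2 / a ^ 2)
  refine hs.of_nonneg_of_le (fun m => by positivity) fun m => ?_
  set N := totalSize (n m)
  have hN : 0 ≤ N := totalSize_nonneg _
  have hpow : Real.exp (-a) ^ (∑ k, n m k) = Real.exp (-a * N) := by
    rw [← Real.exp_nat_mul, mul_comm, Nat.cast_sum]
    rfl
  have hq := Real.quadratic_le_exp_of_nonneg (mul_nonneg ha.le hN)
  -- Half of the decay rate `2 * a` absorbs the polynomial factor.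
  have hN2 : N ^ 2 ≤ 2 / a ^ 2 * Real.exp (a * N) := by
    rw [div_mul_eq_mul_div, le_div_iff₀ (by positivity)]
    nlinarith [mul_nonneg ha.le hN]
  simp only [Function.comp_apply]
  rw [hpow]
  calc _ ≤ (2 / a ^ 2 * Real.exp (a * N)) * Real.exp (-(2 * a) * N) :=
        mul_le_mul_of_nonneg_right hN2 (Real.exp_pos _).le
    _ = _ := by
        rw [mul_assoc, ← Real.exp_add]
        ring_nf

theorem ae_eventually_isQuasirandom [IsProbabilityMeasure μ] (hn : Function.Injective n)
    (hpos : ∀ᶠ m in atTop, 0 < totalSize (n m))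
    (hp : ∀ i j, i ≠ j → p i j ∈ Set.Icc (0 : ℝ) 1) (hps : ∀ i j, p i j = p j i)
    (hG : ∀ m, IsRIM μ (n m) p (G m)) {ε : ℝ} (hε : 0 < ε) :
    ∀ᵐ ω ∂μ, ∀ᶠ m in atTop, IsQuasirandom p (G m ω) (ε * totalSize (n m)) := by
  have hsum : Summable fun m => μ.real {ω | ¬ IsQuasirandom p (G m ω) (ε * totalSize (n m))} := by
    -- With `t = ε * N` the Hoeffding exponent is `-ε ^ 2 * N / 2`, that is `2 * a = ε ^ 2 / 2`.
    have hs := (summable_sq_mul_exp_totalSize hn (a := ε ^ 2 / 4) (by positivity)).mul_left 4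
    refine hs.of_norm_bounded_eventually_nat ?_
    filter_upwards [hpos] with m hm
    rw [Real.norm_of_nonneg measureReal_nonneg]
    refine ((hG m).measureReal_not_isQuasirandom_le hp hps (by positivity)).trans (le_of_eq ?_)
    rw [mul_assoc]
    congr 3
    field_simp
    ring
  have hne : ∑' m, μ {ω | ¬ IsQuasirandom p (G m ω) (ε * totalSize (n m))} ≠ ⊤ := by
    have := hsum.tsum_ofReal_ne_top
    simpa only [measureReal_def, ENNReal.ofReal_toReal (measure_ne_top μ _)] using this
  filter_upwards [ae_eventually_notMem hne] with ω hω
  filter_upwards [hω] with m hm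
  simpa using hm

theorem IsQuasirandom.abs_energy_deviation_le {n : Fin K → ℕ} {G : SimpleGraph (Node n)} {δ : ℝ}
    (hG : IsQuasirandom p G (δ ^ 2 / 8 * totalSize n)) (hδ : 0 ≤ δ) (hδ1 : δ ≤ 1)
    (hp : ∀ i j, i ≠ j → p i j ∈ Set.Icc (0 : ℝ) 1) (hps : ∀ i j, p i j = p j i)
    (hN : 1 ≤ δ ^ 2 / 8 * totalSize n) (f : Node n → ℝ) :
    |(∑ x, ∑ y, deviation p G x y * (f x - f y) ^ 2) / 2| ≤ δ * totalSize n * ∑ x, f x ^ 2 :=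
  abs_sum_mul_sub_sq_le _ (deviation_symm hps G) (totalSize_nonneg n) hδ hδ1
    (totalSize_eq_card n).ge hN (abs_deviation_le hp G) hG.1 hG.2 f

/-- Almost surely, the edges between the clusters have nearly the energy of their expectation. -/
theorem ae_eventually_abs_energy_deviation_le [IsProbabilityMeasure μ] (hn : Function.Injective n)
    (htop : Tendsto (fun m => totalSize (n m)) atTop atTop)
    (hp : ∀ i j, i ≠ j → p i j ∈ Set.Icc (0 : ℝ) 1) (hps : ∀ i j, p i j = p j i)
    (hG : ∀ m, IsRIM μ (n m) p (G m)) :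
    ∀ᵐ ω ∂μ, ∀ δ > 0, ∀ᶠ m in atTop, ∀ f : Node (n m) → ℝ,
      |(∑ x, ∑ y, deviation p (G m ω) x y * (f x - f y) ^ 2) / 2| ≤
        δ * totalSize (n m) * ∑ x, f x ^ 2 := by
  -- Countably many tolerances `1 / (k + 1)` give one null set valid for all `δ`.
  have hk : ∀ k : ℕ, ∀ᵐ ω ∂μ, ∀ᶠ m in atTop,
      IsQuasirandom p (G m ω) ((1 / ((k : ℝ) + 1)) ^ 2 / 8 * totalSize (n m)) := fun k =>
    ae_eventually_isQuasirandom hn (htop.eventually_gt_atTop 0) hp hps hG (by positivity)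
  filter_upwards [ae_all_iff.2 hk] with ω hω δ hδ
  obtain ⟨k, hkδ⟩ := exists_nat_one_div_lt hδ
  have hpos : (0 : ℝ) < 1 / ((k : ℝ) + 1) := by positivity
  have hle : 1 / ((k : ℝ) + 1) ≤ 1 := by
    rw [div_le_one (by positivity)]
    linarith [Nat.cast_nonneg (α := ℝ) k]
  filter_upwards [hω k, (htop.const_mul_atTop
    (show (0 : ℝ) < (1 / ((k : ℝ) + 1)) ^ 2 / 8 by positivity)).eventually_ge_atTop 1]
    with m hm hm1 f
  refine (hm.abs_energy_deviation_le hpos.le hle hp hps hm1 f).trans ?_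
  refine mul_le_mul_of_nonneg_right ?_ (Finset.sum_nonneg fun _ _ => sq_nonneg _)
  exact mul_le_mul_of_nonneg_right hkδ.le (totalSize_nonneg _)

/-! ### Energy decomposition and comparison of two models. -/

section Comparison

variable {K : ℕ} {n : Fin K → ℕ} {p : Fin K → Fin K → ℝ}

open scoped Classical in
/-- The part of the Dirichlet energy that comes from the edges inside the clusters. -/
noncomputable def internalEnergy (G : SimpleGraph (Node n)) (f : Node n → ℝ) : ℝ :=
  (∑ x, ∑ y, if x.1 = y.1 ∧ G.Adj x y then (f x - f y) ^ 2 else 0) / 2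

/-- The expected Dirichlet energy of the edges between the clusters. -/
noncomputable def expectedEnergy (p : Fin K → Fin K → ℝ) (f : Node n → ℝ) : ℝ :=
  (∑ x, ∑ y, if x.1 = y.1 then 0 else p x.1 y.1 * (f x - f y) ^ 2) / 2

theorem energy_eq (p : Fin K → Fin K → ℝ) (G : SimpleGraph (Node n)) (f : Node n → ℝ) :
    energy G f = internalEnergy G f + expectedEnergy p f +
      (∑ x, ∑ y, deviation p G x y * (f x - f y) ^ 2) / 2 := by
  unfold energy internalEnergy expectedEnergy deviation
  rw [← add_div, ← add_div]
  simp_rw [← Finset.sum_add_distrib]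
  congr 1
  refine Finset.sum_congr rfl fun x _ => Finset.sum_congr rfl fun y _ => ?_
  by_cases h : x.1 = y.1 <;> by_cases h' : G.Adj x y <;> simp [h, h'] <;> ring

theorem internalEnergy_congr {G H : SimpleGraph (Node n)}
    (h : ∀ k, cluster G k = cluster H k) (f : Node n → ℝ) :
    internalEnergy G f = internalEnergy H f := by
  classical
  unfold internalEnergy
  congr 1
  refine Finset.sum_congr rfl fun x _ => Finset.sum_congr rfl fun y _ => if_congr ?_ rfl rfl
  refine and_congr_right fun hxy => ?_
  obtain ⟨k, u⟩ := x
  obtain ⟨l, v⟩ := y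
  obtain rfl : k = l := hxy
  exact iff_of_eq (congrArg (fun A : SimpleGraph (Fin (n k)) => A.Adj u v) (h k))

theorem expectedEnergy_mono {p' : Fin K → Fin K → ℝ} (h : ∀ i j, i ≠ j → p i j ≤ p' i j)
    (f : Node n → ℝ) : expectedEnergy p f ≤ expectedEnergy p' f := by
  unfold expectedEnergy
  refine div_le_div_of_nonneg_right
    (Finset.sum_le_sum fun x _ => Finset.sum_le_sum fun y _ => ?_) zero_le_two
  split_ifs with hxy
  · exact le_rfl
  · exact mul_le_mul_of_nonneg_right (h _ _ hxy) (sq_nonneg _)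

theorem expectedEnergy_le {q : ℝ} (hq : 0 ≤ q) (h : ∀ i j, i ≠ j → p i j ≤ q) (f : Node n → ℝ) :
    expectedEnergy p f ≤ q * totalSize n * ∑ x, f x ^ 2 := by
  have h1 : expectedEnergy p f ≤ (∑ x, ∑ y, q * (f x - f y) ^ 2) / 2 := by
    unfold expectedEnergy
    refine div_le_div_of_nonneg_right
      (Finset.sum_le_sum fun x _ => Finset.sum_le_sum fun y _ => ?_) zero_le_two
    split_ifs with hxy
    · positivity
    · exact mul_le_mul_of_nonneg_right (h _ _ hxy) (sq_nonneg _)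
  -- The energy of the complete graph is `n * ‖f‖²` minus the square of the sum.
  have h2 : ∑ x, ∑ y, (f x - f y) ^ 2 =
      2 * (totalSize n * ∑ x, f x ^ 2) - 2 * (∑ x, f x) ^ 2 := by
    simp_rw [sub_sq, Finset.sum_add_distrib, Finset.sum_sub_distrib]
    simp only [Finset.sum_const, Finset.card_univ, nsmul_eq_mul, ← Finset.mul_sum,
      ← Finset.sum_mul, ← totalSize_eq_card]
    ring
  simp_rw [← Finset.mul_sum] at h1
  rw [h2] at h1
  nlinarith [mul_nonneg hq (sq_nonneg (∑ x, f x))]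

/-- The internal energies cancel and the expected cross energy is monotone in the probabilities; the
two deviations cost `δ` each. -/
theorem energy_le_add {G H : SimpleGraph (Node n)} {p' : Fin K → Fin K → ℝ}
    (hcl : ∀ k, cluster G k = cluster H k) (hpp : ∀ i j, i ≠ j → p' i j ≤ p i j) {δ : ℝ}
    {f : Node n → ℝ}
    (hG : |(∑ x, ∑ y, deviation p G x y * (f x - f y) ^ 2) / 2| ≤ δ * totalSize n * ∑ x, f x ^ 2)
    (hH : |(∑ x, ∑ y, deviation p' H x y * (f x - f y) ^ 2) / 2| ≤
      δ * totalSize n * ∑ x, f x ^ 2) :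
    energy H f ≤ energy G f + 2 * δ * totalSize n * ∑ x, f x ^ 2 := by
  rw [energy_eq p G, energy_eq p' H, internalEnergy_congr hcl]
  linarith [expectedEnergy_mono hpp f, neg_le_of_abs_le hG, le_of_abs_le hH]

theorem le_card_node (hpos : ∀ k, 0 < n k) : K ≤ Fintype.card (Node n) := by
  rw [Fintype.card_sigma]
  simpa using Finset.card_nsmul_le_sum Finset.univ (fun k => n k) 1 fun k _ => hpos k

theorem lapEigenvalue_le (hpos : ∀ k, 0 < n k) {q δ : ℝ} (hq : 0 ≤ q)
    (hpq : ∀ i j, i ≠ j → p i j ≤ q) {G : SimpleGraph (Node n)}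
    (hG : ∀ f : Node n → ℝ, |(∑ x, ∑ y, deviation p G x y * (f x - f y) ^ 2) / 2| ≤
      δ * totalSize n * ∑ x, f x ^ 2) {j : ℕ} (hj : 1 ≤ j) (hjK : j ≤ K) :
    lapEigenvalue G j ≤ (q + δ) * totalSize n := by
  have hsurj : Function.Surjective (Sigma.fst : Node n → Fin K) := fun k =>
    ⟨⟨k, ⟨0, hpos k⟩⟩, rfl⟩
  refine lapEigenvalue_le_of_submodule G hj (hjK.trans (le_card_node hpos))
    (LinearMap.range (LinearMap.funLeft ℝ ℝ (Sigma.fst : Node n → Fin K))) ?_ ?_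
  · rw [LinearMap.finrank_range_of_inj (LinearMap.funLeft_injective_of_surjective _ _ _ hsurj)]
    simpa using hjK
  · rintro _ ⟨g, rfl⟩
    set f := LinearMap.funLeft ℝ ℝ (Sigma.fst : Node n → Fin K) g with hf
    have hint : internalEnergy G f = 0 := by
      unfold internalEnergy
      rw [Finset.sum_eq_zero, zero_div]
      refine fun x _ => Finset.sum_eq_zero fun y _ => ?_
      split_ifs with h
      · simp [hf, LinearMap.funLeft_apply, h.1]
      · rfl
    rw [energy_eq p G, hint]
    linarith [expectedEnergy_le hq hpq f, le_of_abs_le (hG f)]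

theorem pMin_le {i j : Fin K} (h : i ≠ j) : pMin p ≤ p i j :=
  ciInf_le (f := fun e : {e : Fin K × Fin K // e.1 ≠ e.2} => p e.1.1 e.1.2)
    (Set.finite_range _).bddBelow ⟨(i, j), h⟩

theorem le_pMax {i j : Fin K} (h : i ≠ j) : p i j ≤ pMax p :=
  le_ciSup (f := fun e : {e : Fin K × Fin K // e.1 ≠ e.2} => p e.1.1 e.1.2)
    (Set.finite_range _).bddAbove ⟨(i, j), h⟩

theorem pMin_nonneg (hp : ∀ i j, i ≠ j → p i j ∈ Set.Icc (0 : ℝ) 1) : 0 ≤ pMin p :=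
  Real.iInf_nonneg fun e => (hp _ _ e.2).1

theorem pMin_le_pMax (hK : 2 ≤ K) (p : Fin K → Fin K → ℝ) : pMin p ≤ pMax p := by
  have h : (⟨0, by omega⟩ : Fin K) ≠ ⟨1, by omega⟩ := by simp
  exact (pMin_le h).trans (le_pMax h)

end Comparison

/-! ### Construction of the homogeneous comparison model. -/

section Existence

variable {K : ℕ}

theorem crossPair_self {n : Fin K → ℕ} (e : CrossPair n) : crossPair e.1.1 e.1.2 e.2.ne = e :=
  dif_pos e.2

/-- The graph with internal graphs `A k` and the edges in `S` between the clusters. -/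
def joinGraph {n : Fin K → ℕ} (A : ∀ k, SimpleGraph (Fin (n k))) (S : Set (CrossPair n)) :
    SimpleGraph (Node n) where
  Adj x y := (∃ k u v, (A k).Adj u v ∧ x = ⟨k, u⟩ ∧ y = ⟨k, v⟩) ∨
    ∃ h : x.1 ≠ y.1, crossPair x y h ∈ S
  symm := by
    constructor
    rintro x y (⟨k, u, v, h, hx, hy⟩ | ⟨h, hS⟩)
    · exact Or.inl ⟨k, v, u, h.symm, hy, hx⟩
    · exact Or.inr ⟨h.symm, by rwa [crossPair_eq_iff.2 (Or.inr ⟨rfl, rfl⟩)]⟩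
  loopless := by
    constructor
    rintro x (⟨k, u, v, h, rfl, hy⟩ | ⟨h, -⟩)
    · exact h.ne (by simpa using hy)
    · exact h rfl

theorem cluster_joinGraph {n : Fin K → ℕ} (A : ∀ k, SimpleGraph (Fin (n k)))
    (S : Set (CrossPair n)) (k : Fin K) : cluster (joinGraph A S) k = A k := by
  ext u v
  simp only [cluster, joinGraph, SimpleGraph.comap_adj]
  constructor
  · rintro (⟨l, u', v', h, hx, hy⟩ | ⟨h, -⟩)
    · obtain ⟨rfl, hu⟩ := Sigma.mk.inj_iff.1 hx
      obtain ⟨-, hv⟩ := Sigma.mk.inj_iff.1 hy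
      rwa [eq_of_heq hu, eq_of_heq hv]
    · exact absurd rfl h
  · exact fun h => Or.inl ⟨k, u, v, h, rfl, rfl⟩

theorem joinGraph_adj {n : Fin K → ℕ} (A : ∀ k, SimpleGraph (Fin (n k)))
    (S : Set (CrossPair n)) {x y : Node n} (h : x.1 ≠ y.1) :
    (joinGraph A S).Adj x y ↔ crossPair x y h ∈ S := by
  constructor
  · rintro (⟨l, u', v', -, rfl, rfl⟩ | ⟨_, hS⟩)
    · exact absurd rfl h
    · exact hS
  · exact fun hS => Or.inr ⟨h, hS⟩

/-- Homogeneous random interconnection models with prescribed internal graphs exist. -/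
theorem exists_isRIM (n : ℕ → Fin K → ℕ) (A : ∀ m k, SimpleGraph (Fin (n m k)))
    (hA : ∀ m k, (A m k).Connected) {q : ℝ} (hq : q ∈ Set.Icc (0 : ℝ) 1) :
    ∃ (Ω : Type) (_ : MeasurableSpace Ω) (μ : Measure Ω) (_ : IsProbabilityMeasure μ)
      (G : ∀ m, Ω → SimpleGraph (Node (n m))),
      (∀ m, IsRIM μ (n m) (fun _ _ => q) (G m)) ∧ ∀ m ω k, cluster (G m ω) k = A m k := by
  let ν : Measure Bool :=
    ENNReal.ofReal q • Measure.dirac true + ENNReal.ofReal (1 - q) • Measure.dirac false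
  have hν : IsProbabilityMeasure ν := ⟨by
    simp [ν, ← ENNReal.ofReal_add hq.1 (sub_nonneg.2 hq.2)]⟩
  have hνt : ν {true} = ENNReal.ofReal q := by simp [ν]
  -- Independent coins over all `m` and all cross pairs: one of the joint distributions covered by
  -- `SeparablePhase`.
  obtain ⟨Ω, hΩ, μ, X, hXm, hX, hind, hμ⟩ := exists_iid ((m : ℕ) × CrossPair (n m)) ν
  have hpre : ∀ i, μ (X i ⁻¹' {true}) = ENNReal.ofReal q := fun i => by
    rw [← Measure.map_apply (hXm i) (MeasurableSet.singleton _), (hX i).map_eq, hνt]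
  have hmeas : ∀ i, MeasurableSet (X i ⁻¹' {true}) := fun i => hXm i (MeasurableSet.singleton _)
  have hset : ∀ m (x y : Node (n m)) (h : x.1 ≠ y.1),
      {ω | (joinGraph (A m) {e | X ⟨m, e⟩ ω = true}).Adj x y} =
        X ⟨m, crossPair x y h⟩ ⁻¹' {true} := fun m x y h => by
    ext ω
    exact joinGraph_adj _ _ h
  refine ⟨Ω, hΩ, μ, hμ, fun m ω => joinGraph (A m) {e | X ⟨m, e⟩ ω = true}, fun m => ?_,
    fun m ω k => cluster_joinGraph _ _ k⟩
  constructor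
  · exact ae_of_all _ fun ω k => by simpa only [cluster_joinGraph] using hA m k
  · exact fun x y h => by rw [hset m x y h]; exact hmeas _
  · exact fun x y h => by rw [hset m x y h]; exact hpre _
  · have heq : (fun e : CrossPair (n m) =>
        {ω | (joinGraph (A m) {e | X ⟨m, e⟩ ω = true}).Adj e.1.1 e.1.2}) =
        fun e => X ⟨m, e⟩ ⁻¹' {true} := by
      funext e
      rw [hset m _ _ e.2.ne, crossPair_self]
    rw [heq, iIndepSet_iff_meas_biInter fun e => hmeas _]
    exact fun s => (hind.precomp (g := Sigma.mk m) sigma_mk_injective).measure_inter_preimage_eq_mul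
      s fun _ _ => MeasurableSet.singleton _

end Existence

theorem separablePhase_of_lt_criticalThreshold {K : ℕ} {n : ℕ → Fin K → ℕ}
    {A : ∀ m k, SimpleGraph (Fin (n m k))} {q r : ℝ} (hq : 0 ≤ q) (hqr : q ≤ r)
    (hr : r < criticalThreshold n A) : q ≤ 1 ∧ SeparablePhase n A q := by
  have hne : {p : ℝ | p ∈ Set.Icc (0 : ℝ) 1 ∧ ∀ q ∈ Set.Icc (0 : ℝ) p,
      SeparablePhase n A q}.Nonempty := by
    by_contra h
    -- The supremum of the empty set is `0` by convention, which contradicts `0 ≤ r <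
    -- criticalThreshold n A`.
    rw [criticalThreshold, Set.not_nonempty_iff_eq_empty.1 h, Real.sSup_empty] at hr
    linarith
  obtain ⟨p, ⟨hp, hsep⟩, hrp⟩ := exists_lt_of_lt_csSup hne hr
  exact ⟨by linarith [hp.2], hsep q ⟨hq, by linarith⟩⟩

/-- Bounding all other terms by `c` turns a lower bound on the sum into one on each term. -/
theorem sum_sub_card_mul_le {ι : Type*} {s : Finset ι} {a : ι → ℝ} {c : ℝ} (h : ∀ i ∈ s, a i ≤ c)
    {j : ι} (hj : j ∈ s) : ∑ i ∈ s, a i - ((s.card : ℝ) - 1) * c ≤ a j := by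
  classical
  have h1 := Finset.sum_le_card_nsmul (s.erase j) a c fun i hi => h i (Finset.mem_of_mem_erase hi)
  rw [nsmul_eq_mul, Finset.cast_card_erase_of_mem hj] at h1
  rw [← Finset.add_sum_erase s a hj]
  linarith

end RIM

/-! ### The main theorem. -/

theorem corollary5 {K : ℕ} (hK : 2 ≤ K)
    {Ω : Type*} [MeasurableSpace Ω] (μ : Measure Ω) [IsProbabilityMeasure μ]
    (n : ℕ → Fin K → ℕ) (hn_inj : Function.Injective n)
    (hn : ∀ k, Tendsto (fun m => n m k) atTop atTop)
    (c : ℝ) (hc : 0 < c)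
    (hratio : Tendsto (fun m => RIM.minSize (n m) / RIM.maxSize (n m)) atTop (𝓝 c))
    (p : Fin K → Fin K → ℝ) (hp : ∀ i j, i ≠ j → p i j ∈ Set.Icc (0 : ℝ) 1)
    (hp_symm : ∀ i j, p i j = p j i)
    (G : ∀ m, Ω → SimpleGraph (RIM.Node (n m)))
    (hG : ∀ m, RIM.IsRIM μ (n m) p (G m)) :
    ∀ᵐ ω ∂μ,
      RIM.pMax p < RIM.criticalThreshold n (fun m k => RIM.cluster (G m ω) k) →
      ∀ j ∈ Finset.Icc 2 K, ∀ ε > 0, ∀ᶠ m in atTop,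
        RIM.pMin p - ε ≤ RIM.lapEigenvalue (G m ω) j / RIM.totalSize (n m) ∧
        RIM.lapEigenvalue (G m ω) j / RIM.totalSize (n m) ≤ RIM.pMax p + ε := by
  have htop : Tendsto (fun m => RIM.totalSize (n m)) atTop atTop := by
    refine tendsto_atTop_mono (fun m => ?_)
      (tendsto_natCast_atTop_atTop.comp (hn ⟨0, by omega⟩))
    exact Finset.single_le_sum (f := fun k => (n m k : ℝ)) (fun _ _ => Nat.cast_nonneg _)
      (Finset.mem_univ _)
  have hpos : ∀ᶠ m in atTop, ∀ k, 0 < n m k :=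
    eventually_all.2 fun k => (hn k).eventually_gt_atTop 0
  have hq0 := RIM.pMin_nonneg hp
  have hqr := RIM.pMin_le_pMax hK p
  have hK0 : (0 : ℝ) ≤ K := Nat.cast_nonneg K
  filter_upwards [ae_all_iff.2 fun m => (hG m).cluster_connected,
    RIM.ae_eventually_abs_energy_deviation_le hn_inj htop hp hp_symm hG] with ω hconn hdev hlt j hj
    ε hε
  obtain ⟨hq1, hsep⟩ := RIM.separablePhase_of_lt_criticalThreshold hq0 hqr hlt
  obtain ⟨Ω', _, μ', _, H, hH, hcl⟩ := RIM.exists_isRIM n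
    (fun m k => RIM.cluster (G m ω) k) hconn ⟨hq0, hq1⟩
  -- A single good outcome of the comparison model suffices.
  obtain ⟨ω', hlim, hdev'⟩ := ((hsep Ω' μ' H hH hcl).and
    (RIM.ae_eventually_abs_energy_deviation_le hn_inj htop (fun _ _ _ => ⟨hq0, hq1⟩)
      (fun _ _ => rfl) hH)).exists
  -- Error budget: `δ` from the limit of the sum, `(K - 2) * δ` from the caps on the other
  -- eigenvalues and `2 * δ` from the comparison.
  obtain ⟨δ, hδ, hδε⟩ : ∃ δ : ℝ, 0 < δ ∧ (K + 1) * δ = ε :=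
    ⟨ε / (K + 1), by positivity, by field_simp⟩
  filter_upwards [hpos, hdev δ hδ, hdev' δ hδ, htop.eventually_gt_atTop 0,
    hlim.eventually_const_lt (sub_lt_self _ hδ)] with m hm hGm hHm hN hS
  have hjK := Finset.mem_Icc.1 hj
  have hj1 : 1 ≤ j := by omega
  constructor
  · have hcomp := RIM.lapEigenvalue_le_add (G m ω) (H m ω') hj1
      (hjK.2.trans (RIM.le_card_node hm)) fun f =>
        RIM.energy_le_add (p := p) (fun k => (hcl m ω' k).symm) (fun _ _ h => RIM.pMin_le h)
          (hGm f) (hHm f)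
    have hup : ∀ i ∈ Finset.Icc 2 K,
        RIM.lapEigenvalue (H m ω') i / RIM.totalSize (n m) ≤ RIM.pMin p + δ := fun i hi => by
      rw [Finset.mem_Icc] at hi
      rw [div_le_iff₀ hN]
      exact RIM.lapEigenvalue_le hm hq0 (fun _ _ _ => le_rfl) hHm (by omega) hi.2
    have hlow := RIM.sum_sub_card_mul_le hup hj
    rw [← Finset.sum_div, Nat.card_Icc, Nat.cast_sub (by omega)] at hlow
    unfold RIM.partialEigenvalueSum at hS
    have hdiv : RIM.lapEigenvalue (H m ω') j / RIM.totalSize (n m) ≤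
        RIM.lapEigenvalue (G m ω) j / RIM.totalSize (n m) + 2 * δ := by
      rw [div_add' _ _ _ hN.ne']
      exact div_le_div_of_nonneg_right hcomp hN.le
    push_cast at hlow
    nlinarith
  · rw [div_le_iff₀ hN]
    refine (RIM.lapEigenvalue_le hm (hq0.trans hqr) (fun _ _ h => RIM.le_pMax h) hGm hj1
      hjK.2).trans (mul_le_mul_of_nonneg_right ?_ hN.le)
    nlinarith
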